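/- Let $\overline{\mathbb Q}\subset\mathbb C$ be the field of algebraic numbers. For a polynomial $f\in\mathbb C[z]$ let $C_f=\{c\in\mathbb C: f'(c)=0\}$, let $f^{\circ n}$ be the $n$-fold composition of $f$ with itself, and let $P_f=\overline{\bigcup_{n>0}f^{\circ n}(C_f)}$; the local degree of a nonconstant $f$ at $z$ is the multiplicity of $z$ as a root of $f-f(z)$. A Belyi polynomial is a nonconstant polynomial with $f(C_f)\subset\{0,1\}$; it is clean if its local degree at every point of $f^{-1}(1)$ is exactly $2$. Let $XDBP$ be the set of extra-clean dynamical Belyi polynomials, that is, of clean Belyi polynomials $f\in\overline{\mathbb Q}[z]$ of degree at least $3$ such that $P_f\subset\{0,1\}$, $f(0)=f(1)=0$, and the local degrees of $f$ at $0$ and at $1$ are both equal to $1$. All iterates of such an $f$ are Belyi polynomials. For a Belyi polynomial $F$ and a base point $b\in\mathbb C\setminus\{0,1\}$, let $\mathrm{Mon}(F)$ be the monodromy group of the covering $F:\mathbb C\setminus F^{-1}(\{0,1\})\to\mathbb C\setminus\{0,1\}$, i.e. the image of $\pi_1(\mathbb C\setminus\{0,1\},b)$ in the group of permutations of the fiber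 $F^{-1}(b)$. Permutation groups $G$ on a set $A$ and $H$ on a set $B$ are permutation-isomorphic if there is a bijection $\tau:A\to B$ with $H=\tau G\tau^{-1}$. For $\sigma\in\mathrm{Gal}(\overline{\mathbb Q}/\mathbb Q)$ let $f^\sigma$ be the polynomial obtained from $f\in\overline{\mathbb Q}[z]$ by applying $\sigma$ to its coefficients. **Theorem.** If $f,g\in XDBP$ and $g=f^\sigma$ for some $\sigma\in\mathrm{Gal}(\overline{\mathbb Q}/\mathbb Q)$, then for every integer $n>0$ the groups $\mathrm{Mon}(f^{\circ n})$ and $\mathrm{Mon}(g^{\circ n})$ are permutation-isomorphic, for any choice of the two base points in $\mathbb C\setminus\{0,1\}$. -/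

import Mathlib

open Polynomial

noncomputable section

/-- The field of algebraic numbers, as a subfield of `ℂ`. -/
abbrev QBar : IntermediateField ℚ ℂ := algebraicClosure ℚ ℂ

namespace BelyiPolynomial

/-- A polynomial with algebraic coefficients, regarded as a complex polynomial. -/
def toComplex (f : QBar[X]) : ℂ[X] := f.map (algebraMap QBar ℂ)

/-- The twist `f^σ`: apply `σ` to every coefficient. -/
def twist (σ : Gal(QBar/ℚ)) (f : QBar[X]) : QBar[X] := f.map (σ : QBar →+* QBar)

/-- The `n`-th iterate `f^{∘n}`, the composition of `n` copies of `f`. -/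
def iter {R : Type*} [CommSemiring R] (f : R[X]) (n : ℕ) : R[X] := f.comp^[n] X

/-- The set `C_F` of (finite) critical points. -/
def criticalPoints (F : ℂ[X]) : Set ℂ := {z | F.derivative.eval z = 0}

/-- The set `V_F = F(C_F)` of (finite) critical values. -/
def criticalValues (F : ℂ[X]) : Set ℂ := (fun z => F.eval z) '' criticalPoints F

/-- The postcritical set `P_F`, the closure of `⋃_{n > 0} F^{∘n}(C_F)`. -/
def postcriticalSet (F : ℂ[X]) : Set ℂ :=
  closure (⋃ n : ℕ, ⋃ _ : 0 < n, (fun z => F.eval z)^[n] '' criticalPoints F)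

/-- The local degree of `F` at `z`: the multiplicity of `z` as a root of `F - F(z)`. -/
def localDegree (F : ℂ[X]) (z : ℂ) : ℕ := (F - C (F.eval z)).rootMultiplicity z

/-- A (not necessarily clean) Belyi polynomial: nonconstant, with finite critical values
in `{0, 1}`. -/
structure IsBelyi (F : ℂ[X]) : Prop where
  natDegree_pos : 0 < F.natDegree
  criticalValues_subset : criticalValues F ⊆ {0, 1}

/-- A clean Belyi polynomial: the ramification at each point over `1` is exactly two. -/
structure IsCleanBelyi (F : ℂ[X]) : Prop extends IsBelyi F where
  localDegree_of_eval_eq_one : ∀ z : ℂ, F.eval z = 1 → localDegree F z = 2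

/-- A dynamical Belyi polynomial. -/
structure IsDBP (F : ℂ[X]) : Prop extends IsCleanBelyi F where
  three_le_natDegree : 3 ≤ F.natDegree
  postcriticalSet_subset : postcriticalSet F ⊆ {0, 1}

/-- An extra-clean dynamical Belyi polynomial. -/
structure IsXDBP (F : ℂ[X]) : Prop extends IsDBP F where
  eval_zero : F.eval 0 = 0
  eval_one : F.eval 1 = 0
  localDegree_zero : localDegree F 0 = 1
  localDegree_one : localDegree F 1 = 1

/-- The set `XDBP` of extra-clean dynamical Belyi polynomials, with algebraic coefficients. -/
def XDBP : Set QBar[X] := {f | IsXDBP (toComplex f)}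

/-- The twice punctured plane `ℂ ∖ {0, 1}`. -/
abbrev puncturedPlane : Set ℂ := {0, 1}ᶜ

/-- The map `F : ℂ ∖ F⁻¹({0, 1}) → ℂ ∖ {0, 1}`. -/
def restrictedMap (F : ℂ[X]) :
    ((fun z => F.eval z) ⁻¹' puncturedPlane : Set ℂ) → puncturedPlane :=
  puncturedPlane.restrictPreimage (fun z => F.eval z)

/-- The fiber of `F` over the base point `b`, on which the monodromy group acts. -/
abbrev Fiber (F : ℂ[X]) (b : puncturedPlane) : Type :=
  (restrictedMap F ⁻¹' {b} : Set ((fun z => F.eval z) ⁻¹' puncturedPlane : Set ℂ))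

theorem IsBelyi.isCoveringMap {F : ℂ[X]} (hF : IsBelyi F) : IsCoveringMap (restrictedMap F) := by
  have h : IsCoveringMapOn (fun z => F.eval z) puncturedPlane := by
    exact F.isCoveringMapOn_eval.mono (Set.compl_subset_compl.mpr hF.criticalValues_subset)
  exact h.isCoveringMap_restrictPreimage

/-- The monodromy group `Mon(F)` of the covering `F : ℂ ∖ F⁻¹({0, 1}) → ℂ ∖ {0, 1}`, as a group
of permutations of the fiber over `b`: the image of the fundamental group of `ℂ ∖ {0, 1}`. -/
def Mon {F : ℂ[X]} (hF : IsBelyi F) (b : puncturedPlane) : Subgroup (Equiv.Perm (Fiber F b)) :=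
  (hF.isCoveringMap.monodromyPerm b).range

/-- Permutation groups `G` on `α` and `H` on `β` are permutation-isomorphic if `H = τ G τ⁻¹` for
some bijection `τ : α → β`. -/
def PermIsomorphic {α β : Type*} (G : Subgroup (Equiv.Perm α)) (H : Subgroup (Equiv.Perm β)) :
    Prop :=
  ∃ τ : α ≃ β, H = G.map (τ.permCongrHom : Equiv.Perm α →* Equiv.Perm β)

theorem toComplex_iter (f : QBar[X]) (n : ℕ) : toComplex (iter f n) = iter (toComplex f) n := by
  induction n with
  | zero => simp [iter, toComplex]
  | succ n ih =>
    simp only [iter, Function.iterate_succ_apply'] at ih ⊢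
    rw [← ih]
    simp [toComplex, Polynomial.map_comp]

/-- Every iterate of a dynamical Belyi polynomial is a (not necessarily clean) Belyi polynomial. -/
theorem IsDBP.isBelyi_iter {F : ℂ[X]} (hF : IsDBP F) (n : ℕ) : IsBelyi (iter F n) := by
  have key : ∀ (n : ℕ) (z : ℂ), (iter F n).derivative.eval z = 0 →
      ∃ c ∈ criticalPoints F, ∃ m : ℕ, 0 < m ∧ (fun w => F.eval w)^[m] c = (iter F n).eval z := by
    intro n
    induction n with
    | zero => intro z hz; simp [iter] at hz
    | succ n ih =>
      intro z hz
      have hs : iter F (n + 1) = F.comp (iter F n) := by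
        simp only [iter, Function.iterate_succ_apply']
      rw [hs, derivative_comp, eval_mul, eval_comp, mul_eq_zero] at hz
      rcases hz with hz | hz
      · obtain ⟨c, hc, m, -, hmc⟩ := ih z hz
        exact ⟨c, hc, m + 1, Nat.succ_pos m, by
          rw [Function.iterate_succ_apply', hmc, hs, eval_comp]⟩
      · exact ⟨(iter F n).eval z, hz, 1, one_pos, by rw [hs, eval_comp]; rfl⟩
  refine ⟨?_, ?_⟩
  · simp only [iter, natDegree_iterate_comp, natDegree_X, mul_one]
    exact pow_pos hF.natDegree_pos n
  · rintro _ ⟨z, hz, rfl⟩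
    obtain ⟨c, hc, m, hm, hmc⟩ := key n z hz
    refine hF.postcriticalSet_subset (subset_closure ?_)
    exact Set.mem_iUnion₂.mpr ⟨m, hm, c, hc, hmc⟩

theorem isBelyi_toComplex_iter {f : QBar[X]} (hf : f ∈ XDBP) (n : ℕ) :
    IsBelyi (toComplex (iter f n)) := by
  rw [toComplex_iter]
  exact IsDBP.isBelyi_iter (IsXDBP.toIsDBP hf) n

end BelyiPolynomial

end

/-! Monodromy is topological while `σ` acts discontinuously on algebraic numbers, so the group has
to be encoded in something algebraic. Let `F` be an iterate of `f`, `G` its monodromy group over the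
rational point 2, and `z` the tuple of points of that fiber. The polynomial `orbitSum G z x` is
invariant under reordering `x` by `G`, and at `x = z ∘ ρ` it is nonzero exactly when `ρ ∈ G`.

Substitute for `x` the transport of `z` along a path from 2 to `t`. By invariance the result depends
on `t` alone; it is holomorphic off `{0, 1}` and of polynomial growth, hence a polynomial `c` in `t`
(`IsBelyi.exists_eval_eq_orbitSum`). Its values at algebraic points are algebraic, so its
coefficients are too, and `σ` can be applied to them.

At a rational `t` near 2, the conjugate of `c` is the orbit sum of the fiber of the conjugate of
`F`, up to a relabelling; nonvanishing at 2 forces the relabelling into `G`. Such points accumulate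
at 2, so the identity theorem gives the relation near 2, and continuation along loops
(`eq_zero_of_transport`) puts the monodromy of the conjugate inside a conjugate of `G`
(`exists_mon_twist_le`). The same for `σ⁻¹`, with a count of elements, gives equality. Twisting
commutes with iteration, and a path between base points conjugates the monodromy groups. -/

noncomputable section

open Filter Topology Metric

/-! ### Polynomials recognised by their values and by their growth -/

/-- A polynomial over `L` which takes values in the subfield `K` at infinitely many points of `K`
has coefficients in `K`. -/
theorem Polynomial.exists_map_eq_of_infinite_eval_mem {K L : Type*} [Field K] [Field L]
    [Algebra K L] (c : L[X]) {S : Set K} (hS : S.Infinite)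
    (h : ∀ q ∈ S, ∃ y : K, c.eval (algebraMap K L q) = algebraMap K L y) :
    ∃ p : K[X], p.map (algebraMap K L) = c := by
  classical
  obtain ⟨s, hsS, hs⟩ := hS.exists_subset_card_eq (c.natDegree + 1)
  choose! r hr using h
  have hinj : Set.InjOn (algebraMap K L) (s : Set K) := (algebraMap K L).injective.injOn
  refine ⟨Lagrange.interpolate s id r, ?_⟩
  refine Polynomial.eq_of_degrees_lt_of_eval_index_eq (s := s) (v := algebraMap K L) hinj ?_ ?_ ?_
  · exact degree_map_le.trans_lt (Lagrange.degree_interpolate_lt _ Function.injective_id.injOn)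
  · rw [hs]
    exact degree_le_natDegree.trans_lt (by exact_mod_cast Nat.lt_succ_self _)
  · intro q hq
    rw [eval_map_algebraMap, aeval_algebraMap_apply, coe_aeval_eq_eval, hr q (hsS hq)]
    congr 1
    exact Lagrange.eval_interpolate_at_node (v := id) r Function.injective_id.injOn hq

/-- The preimages of a point under a nonconstant polynomial grow at most linearly. -/
theorem Polynomial.exists_norm_le_of_eval_eq {F : ℂ[X]} (hF : 0 < F.natDegree) :
    ∃ K : ℝ, 0 < K ∧ ∀ z t : ℂ, F.eval z = t → ‖z‖ ≤ K * (1 + ‖t‖) := by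
  have hF0 : F ≠ 0 := by rintro rfl; simp at hF
  set l : ℝ := ‖F.leadingCoeff‖ with hl
  have hl0 : 0 < l := norm_pos_iff.mpr (leadingCoeff_ne_zero.mpr hF0)
  set M : ℝ := ∑ i ∈ Finset.range F.natDegree, ‖F.coeff i‖ with hM
  have hM0 : 0 ≤ M := Finset.sum_nonneg fun _ _ => norm_nonneg _
  refine ⟨(M + 1) / l + 1, by positivity, fun z t hzt => ?_⟩
  have hd : (F - C t).natDegree = F.natDegree := natDegree_sub_C
  have hne : F - C t ≠ 0 := by rintro h; rw [h] at hd; simp at hd; omega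
  have hroot : (F - C t).IsRoot z := by simp [hzt]
  have hlead : (F - C t).leadingCoeff = F.leadingCoeff := by
    rw [leadingCoeff, hd, coeff_sub, coeff_C_of_ne_zero hF.ne', sub_zero, leadingCoeff]
  have h1 : (‖z‖₊ : ℝ) < cauchyBound (F - C t) :=
    NNReal.coe_lt_coe.mpr (hroot.norm_lt_cauchyBound hne)
  have h2 : ((Finset.range (F - C t).natDegree).sup (fun i => ‖(F - C t).coeff i‖₊) : NNReal) ≤
      Real.toNNReal (M + ‖t‖) := by
    refine Finset.sup_le fun i hi => ?_
    rw [hd] at hi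
    refine NNReal.le_toNNReal_of_coe_le ?_
    rw [coe_nnnorm, coeff_sub]
    refine (norm_sub_le _ _).trans (add_le_add ?_ ?_)
    · exact Finset.single_le_sum (f := fun i => ‖F.coeff i‖) (fun _ _ => norm_nonneg _) hi
    · rw [coeff_C]; split_ifs <;> simp
  have h3 : (cauchyBound (F - C t) : ℝ) ≤ (M + ‖t‖) / l + 1 := by
    rw [cauchyBound, hlead, NNReal.coe_add, NNReal.coe_div, NNReal.coe_one, coe_nnnorm]
    gcongr
    exact (NNReal.coe_le_coe.mpr h2).trans_eq (Real.coe_toNNReal _ (by positivity))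
  calc ‖z‖ ≤ (M + ‖t‖) / l + 1 := (h1.trans_le h3).le
    _ ≤ ((M + 1) / l + 1) * (1 + ‖t‖) := by
      have := norm_nonneg t
      rw [add_mul, div_mul_eq_mul_div]
      gcongr <;> nlinarith

/-- An entire function of polynomial growth is a polynomial. -/
theorem Differentiable.exists_polynomial_of_norm_le {φ : ℂ → ℂ} (hφ : Differentiable ℂ φ)
    {K : ℝ} {N : ℕ} (hb : ∀ t, ‖φ t‖ ≤ K * (1 + ‖t‖) ^ N) :
    ∃ c : ℂ[X], ∀ t, c.eval t = φ t := by
  -- Cauchy's estimate on the circle of radius `R`, with `R → ∞`.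
  have hzero : ∀ n, N < n → iteratedDeriv n φ 0 = 0 := by
    intro n hn
    rw [← norm_le_zero_iff]
    have hlim : Tendsto (fun R : ℝ => n.factorial * K * ((1 + R) ^ N / R ^ n)) atTop (𝓝 0) := by
      have : Tendsto (fun R : ℝ => (1 + R) ^ N / R ^ n) atTop (𝓝 0) := by
        have := Polynomial.div_tendsto_atTop_zero_of_degree_lt ((1 + X : ℝ[X]) ^ N) (X ^ n) (by
          rw [degree_pow, degree_X_pow, add_comm]
          have : (X + 1 : ℝ[X]).degree = 1 := degree_X_add_C 1
          rw [this]; simpa using hn)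
        simpa using this
      simpa using this.const_mul (n.factorial * K)
    refine ge_of_tendsto hlim ?_
    filter_upwards [eventually_gt_atTop 0] with R hR
    have := Complex.norm_iteratedDeriv_le_of_forall_mem_sphere_norm_le (c := 0) n hR
      hφ.diffContOnCl (C := K * (1 + R) ^ N) fun z hz => by
        have := hb z
        rwa [mem_sphere_zero_iff_norm.mp hz] at this
    refine this.trans_eq ?_
    ring
  refine ⟨∑ n ∈ Finset.range (N + 1), C ((n.factorial : ℂ)⁻¹ * iteratedDeriv n φ 0) * X ^ n,
    fun t => ?_⟩
  rw [← Complex.taylorSeries_eq_of_entire' 0 t hφ, eval_finsetSum]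
  rw [tsum_eq_sum (s := Finset.range (N + 1))]
  · simp
  · intro n hn
    rw [hzero n (by simpa using hn)]
    simp

/-- A holomorphic function on the twice punctured plane of polynomial growth is a polynomial. -/
theorem DifferentiableOn.exists_polynomial_of_norm_le {φ : ℂ → ℂ} {a b : ℂ}
    (hφ : DifferentiableOn ℂ φ {a, b}ᶜ) {K : ℝ} {N : ℕ}
    (hb : ∀ t ∈ ({a, b}ᶜ : Set ℂ), ‖φ t‖ ≤ K * (1 + ‖t‖) ^ N) :
    ∃ c : ℂ[X], ∀ t ∈ ({a, b}ᶜ : Set ℂ), c.eval t = φ t := by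
  classical
  have hK : 0 ≤ K := by
    obtain ⟨t, ht⟩ := (Set.toFinite ({a, b} : Set ℂ)).infinite_compl.nonempty
    exact nonneg_of_mul_nonneg_left ((norm_nonneg _).trans (hb t ht)) (by positivity)
  -- One puncture is filled at a time: the growth bound makes `ψ` bounded near `p`, so the
  -- singularity is removable, and the same bound passes to `p` by continuity.
  have key : ∀ (ψ : ℂ → ℂ) (p : ℂ) (T : Set ℂ), T.Finite → p ∉ T →
      DifferentiableOn ℂ ψ (insert p T)ᶜ →
      (∀ t ∈ (insert p T)ᶜ, ‖ψ t‖ ≤ K * (1 + ‖t‖) ^ N) →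
      ∃ ψ' : ℂ → ℂ, DifferentiableOn ℂ ψ' Tᶜ ∧ (∀ t ∈ Tᶜ, ‖ψ' t‖ ≤ K * (1 + ‖t‖) ^ N) ∧
        ∀ t ∈ (insert p T)ᶜ, ψ' t = ψ t := by
    intro ψ p T hT hpT hψ hbd
    have hTo : IsOpen Tᶜ := hT.isClosed.isOpen_compl
    set ψ' := Function.update ψ p (limUnder (𝓝[≠] p) ψ) with hψ'
    have heq : ∀ t ∈ (insert p T)ᶜ, ψ' t = ψ t := by
      intro t ht
      have : t ≠ p := by rintro rfl; simp at ht
      simp [hψ', this]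
    have hd : DifferentiableOn ℂ ψ' (Tᶜ ∩ ball p 1) := by
      refine Complex.differentiableOn_update_limUnder_of_bddAbove
        (inter_mem (hTo.mem_nhds hpT) (ball_mem_nhds p one_pos)) (hψ.mono ?_) ?_
      · rintro t ⟨⟨h1, -⟩, h2⟩
        simpa using ⟨h2, h1⟩
      · refine ⟨K * (1 + (‖p‖ + 1)) ^ N, ?_⟩
        rintro _ ⟨t, ⟨⟨h1, h3⟩, h2⟩, rfl⟩
        refine (hbd t (by simpa using ⟨h2, h1⟩)).trans ?_
        have : ‖t‖ ≤ ‖p‖ + 1 := by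
          have h4 := norm_sub_norm_le t p
          rw [mem_ball, dist_eq_norm] at h3
          linarith
        gcongr
    have hd' : DifferentiableOn ℂ ψ' Tᶜ := by
      intro t ht
      by_cases htp : t = p
      · subst htp
        exact (hd.differentiableAt
          (inter_mem (hTo.mem_nhds ht) (ball_mem_nhds t one_pos))).differentiableWithinAt
      · have hmem : t ∈ (insert p T)ᶜ := by simpa using ⟨htp, ht⟩
        have hn : (insert p T)ᶜ ∈ 𝓝 t := (hT.insert p).isClosed.isOpen_compl.mem_nhds hmem
        refine ((hψ.differentiableAt hn).congr_of_eventuallyEq ?_).differentiableWithinAt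
        filter_upwards [hn] with s hs using heq s hs
    refine ⟨ψ', hd', fun t ht => ?_, heq⟩
    by_cases htp : t = p
    · subst htp
      have hc : ContinuousAt ψ' t := (hd'.differentiableAt (hTo.mem_nhds ht)).continuousAt
      have hc2 : ContinuousAt (fun s : ℂ => K * (1 + ‖s‖) ^ N) t := by fun_prop
      refine le_of_tendsto_of_tendsto (hc.norm.tendsto.mono_left (nhdsWithin_le_nhds (s := {t}ᶜ)))
        (hc2.tendsto.mono_left nhdsWithin_le_nhds) ?_
      filter_upwards [self_mem_nhdsWithin, nhdsWithin_le_nhds (hTo.mem_nhds ht)] with s hs hs'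
      have hmem : s ∈ (insert t T)ᶜ := by simpa using ⟨hs, hs'⟩
      rw [heq s hmem]
      exact hbd s hmem
    · have hmem : t ∈ (insert p T)ᶜ := by simpa using ⟨htp, ht⟩
      rw [heq t hmem]
      exact hbd t hmem
  by_cases hab : a = b
  · subst hab
    obtain ⟨ψ, h1, h2, h3⟩ := key φ a ∅ Set.finite_empty (by simp) (by simpa using hφ)
      (by simpa using hb)
    obtain ⟨c, hc⟩ := Differentiable.exists_polynomial_of_norm_le (φ := ψ)
      (by simpa [differentiableOn_univ] using h1) (by simpa using h2)
    exact ⟨c, fun t ht => (hc t).trans (h3 t (by simpa using ht))⟩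
  · obtain ⟨ψ, h1, h2, h3⟩ := key φ a {b} (Set.finite_singleton b) (by simpa using hab) hφ hb
    obtain ⟨ψ', h1', h2', h3'⟩ := key ψ b ∅ Set.finite_empty (by simp) (by simpa using h1)
      (by simpa using h2)
    obtain ⟨c, hc⟩ := Differentiable.exists_polynomial_of_norm_le (φ := ψ')
      (by simpa [differentiableOn_univ] using h1') (by simpa using h2')
    refine ⟨c, fun t ht => (hc t).trans ?_⟩
    rw [h3' t (by simp at ht ⊢; exact ht.2), h3 t ht]

namespace BelyiPolynomial

/-! ### Fibers, transport along paths, and local holomorphic sections -/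

theorem isOpen_puncturedPlane : IsOpen puncturedPlane :=
  (Set.toFinite ({0, 1} : Set ℂ)).isClosed.isOpen_compl

instance : PathConnectedSpace puncturedPlane :=
  isPathConnected_iff_pathConnectedSpace.mp <|
    (Set.toFinite ({0, 1} : Set ℂ)).countable.isPathConnected_compl_of_one_lt_rank
      (by rw [Complex.rank_real_complex]; norm_num)

theorem Fiber.eval_eq {F : ℂ[X]} {b : puncturedPlane} (e : Fiber F b) : F.eval e.1.1 = b.1 :=
  congr_arg Subtype.val e.2

theorem Fiber.coe_injective {F : ℂ[X]} {b : puncturedPlane} :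
    Function.Injective fun e : Fiber F b => (e.1.1 : ℂ) :=
  Subtype.val_injective.comp Subtype.val_injective

/-- A preimage of `b` as a point of the fiber. -/
def Fiber.mk {F : ℂ[X]} {b : puncturedPlane} (z : ℂ) (hz : F.eval z = b.1) : Fiber F b :=
  ⟨⟨z, by rw [Set.mem_preimage, hz]; exact b.2⟩, Subtype.ext hz⟩

theorem IsBelyi.finite_fiber {F : ℂ[X]} (hF : IsBelyi F) (b : puncturedPlane) :
    Finite (Fiber F b) := by
  have hne : F - C b.1 ≠ 0 := by
    intro h
    have hd : (F - C b.1).natDegree = F.natDegree := natDegree_sub_C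
    have := hF.natDegree_pos
    rw [h] at hd
    simp at hd
    omega
  refine Finite.of_injective
    (fun e : Fiber F b => (⟨e.1.1, ?_⟩ : {z : ℂ // z ∈ (F - C b.1).roots.toFinset})) ?_
  · simp [hne, e.eval_eq]
  · intro e e' h
    exact Fiber.coe_injective (Subtype.mk.inj h)

theorem IsBelyi.nonempty_fiber {F : ℂ[X]} (hF : IsBelyi F) (b : puncturedPlane) :
    Nonempty (Fiber F b) := by
  obtain ⟨z, hz⟩ := Complex.exists_root (f := F - C b.1) (by
    rw [degree_sub_C (natDegree_pos_iff_degree_pos.mp hF.natDegree_pos)]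
    exact natDegree_pos_iff_degree_pos.mp hF.natDegree_pos)
  exact ⟨Fiber.mk z (by simpa [sub_eq_zero] using hz)⟩

theorem IsBelyi.derivative_ne_zero {F : ℂ[X]} (hF : IsBelyi F) {z : ℂ}
    (hz : F.eval z ∈ puncturedPlane) : F.derivative.eval z ≠ 0 :=
  fun h => hz (hF.criticalValues_subset ⟨z, h, rfl⟩)

/-- Transport of the fiber over `b` along a class of paths, with values in `ℂ`. -/
def transport {F : ℂ[X]} (hF : IsBelyi F) {b t : puncturedPlane}
    (γ : Path.Homotopic.Quotient b t) (e : Fiber F b) : ℂ :=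
  (hF.isCoveringMap.monodromy γ e).1.1

theorem eval_transport {F : ℂ[X]} (hF : IsBelyi F) {b t : puncturedPlane}
    (γ : Path.Homotopic.Quotient b t) (e : Fiber F b) : F.eval (transport hF γ e) = t :=
  Fiber.eval_eq _

theorem transport_injective {F : ℂ[X]} (hF : IsBelyi F) {b t : puncturedPlane}
    (γ : Path.Homotopic.Quotient b t) : Function.Injective (transport hF γ) :=
  Fiber.coe_injective.comp (hF.isCoveringMap.monodromy_bijective γ).1

theorem exists_transport_eq {F : ℂ[X]} (hF : IsBelyi F) {b t : puncturedPlane}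
    (γ : Path.Homotopic.Quotient b t) {z : ℂ} (hz : F.eval z = t) :
    ∃ e, transport hF γ e = z := by
  obtain ⟨e, he⟩ := (hF.isCoveringMap.monodromy_bijective γ).2 (Fiber.mk z hz)
  exact ⟨e, by rw [transport, he]; rfl⟩

/-- Around every base point there are holomorphic sections through all points of the fiber, which
compute the transport along short paths. -/
theorem IsBelyi.exists_sections {F : ℂ[X]} (hF : IsBelyi F) (t₀ : puncturedPlane) :
    ∃ r > 0, ball t₀.1 r ⊆ puncturedPlane ∧ ∃ s : Fiber F t₀ → ℂ → ℂ,
      (∀ e, DifferentiableOn ℂ (s e) (ball t₀.1 r)) ∧ (∀ e, s e t₀ = e.1.1) ∧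
      (∀ e, ∀ t ∈ ball t₀.1 r, F.eval (s e t) = t) ∧
      ∀ t : puncturedPlane, t.1 ∈ ball t₀.1 r →
        ∃ γ : Path.Homotopic.Quotient t₀ t, ∀ e, transport hF γ e = s e t := by
  obtain ⟨r, hr, hball⟩ := Metric.isOpen_iff.mp isOpen_puncturedPlane t₀.1 t₀.2
  refine ⟨r, hr, hball, ?_⟩
  have hne : (ball t₀.1 r).Nonempty := ⟨t₀.1, mem_ball_self hr⟩
  have : ContractibleSpace (ball t₀.1 r) := (convex_ball _ _).contractibleSpace hne
  have : LocallyPathConnectedSpace (ball t₀.1 r) := isOpen_ball.locallyPathConnectedSpace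
  let i : C(ball t₀.1 r, puncturedPlane) := ⟨Set.inclusion hball, continuous_inclusion hball⟩
  let a₀ : ball t₀.1 r := ⟨t₀.1, mem_ball_self hr⟩
  -- The ball is contractible and locally path connected, so its inclusion lifts through the
  -- covering.
  have hlift : ∀ e : Fiber F t₀, ∃ S : C(ball t₀.1 r, _), S a₀ = e.1 ∧ restrictedMap F ∘ S = i :=
    fun e => (hF.isCoveringMap.existsUnique_continuousMap_lifts i a₀ e.1 e.2).exists
  choose S hS0 hSi using hlift
  have hval : ∀ e (t : ball t₀.1 r), F.eval (S e t).1 = t.1 := fun e t =>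
    congr_arg Subtype.val (congr_fun (hSi e) t)
  classical
  let s : Fiber F t₀ → ℂ → ℂ := fun e t => if h : t ∈ ball t₀.1 r then (S e ⟨t, h⟩).1 else 0
  have hs : ∀ e t (h : t ∈ ball t₀.1 r), s e t = (S e ⟨t, h⟩).1 := fun e t h => dif_pos h
  have hsF : ∀ e, ∀ t ∈ ball t₀.1 r, F.eval (s e t) = t := fun e t h => by
    rw [hs e t h]; exact hval e ⟨t, h⟩
  have hsc : ∀ e, ContinuousOn (s e) (ball t₀.1 r) := by
    intro e
    rw [continuousOn_iff_continuous_domRestrict]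
    have : (ball t₀.1 r).domRestrict (s e) = fun t => (S e t).1 := funext fun t => hs e t.1 t.2
    rw [this]
    exact continuous_subtype_val.comp (S e).continuous
  refine ⟨s, fun e t ht => ?_, fun e => ?_, hsF, fun t ht => ?_⟩
  · have hnhds := isOpen_ball.mem_nhds ht
    -- A continuous local right inverse of `F` is holomorphic where `F'` does not vanish, which
    -- holds over the punctured plane.
    refine (HasDerivAt.of_local_left_inverse (f := fun z => F.eval z)
      ((hsc e).continuousAt hnhds) (F.hasDerivAt (s e t)) ?_ ?_).differentiableAt
      |>.differentiableWithinAt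
    · exact hF.derivative_ne_zero (by rw [hsF e t ht]; exact hball ht)
    · filter_upwards [hnhds] with t' ht' using hsF e t' ht'
  · rw [hs e _ (mem_ball_self hr)]
    exact congr_arg Subtype.val (hS0 e)
  · let p : Path a₀ ⟨t.1, ht⟩ := PathConnectedSpace.somePath _ _
    refine ⟨.mk (p.map i.continuous), fun e => ?_⟩
    have hey : restrictedMap F (S e ⟨t.1, ht⟩) = t := congr_fun (hSi e) _
    have key : hF.isCoveringMap.monodromy (.mk (p.map i.continuous)) e = ⟨S e ⟨t.1, ht⟩, hey⟩ := by
      refine hF.isCoveringMap.monodromy_eq_of_map_eq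
        (.mk ((p.map (S e).continuous).cast (hS0 e).symm rfl)) ?_
      refine congr_arg Path.Homotopic.Quotient.mk ?_
      ext x
      exact congr_arg Subtype.val (congr_fun (hSi e) (p x))
    rw [hs e _ ht, transport]
    exact congr_arg (fun e => e.1.1) key

/-- Transport along a path `p` from `b` to `b'` is the bijection; on loops it corresponds to
conjugation by `p`. -/
theorem permIsomorphic_mon_of_basePoint {F : ℂ[X]} (hF : IsBelyi F) (b b' : puncturedPlane) :
    PermIsomorphic (Mon hF b) (Mon hF b') := by
  let p : Path.Homotopic.Quotient b b' := .mk (PathConnectedSpace.somePath b b')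
  let τ : Fiber F b ≃ Fiber F b' :=
    Equiv.ofBijective _ (hF.isCoveringMap.monodromy_bijective p)
  have hτ : ∀ e, τ e = hF.isCoveringMap.monodromy p e := fun _ => rfl
  have hτs : ∀ e, τ.symm e = hF.isCoveringMap.monodromy p.symm e := by
    intro e
    rw [Equiv.symm_apply_eq, hτ, ← IsCoveringMap.monodromy_trans_apply,
      Path.Homotopic.Quotient.symm_trans, IsCoveringMap.monodromy_refl, id]
  refine ⟨τ, ?_⟩
  ext h
  rw [Subgroup.mem_map]
  constructor
  · rintro ⟨γ, rfl⟩
    refine ⟨_, ⟨(p.trans γ).trans p.symm, rfl⟩, ?_⟩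
    ext1 e
    change τ (hF.isCoveringMap.monodromy ((p.trans γ).trans p.symm) (τ.symm e)) =
      hF.isCoveringMap.monodromy γ e
    rw [IsCoveringMap.monodromy_trans_apply, IsCoveringMap.monodromy_trans_apply, ← hτ, ← hτs]
    simp
  · rintro ⟨_, ⟨γ, rfl⟩, rfl⟩
    refine ⟨(p.symm.trans γ).trans p, ?_⟩
    ext1 e
    change hF.isCoveringMap.monodromy ((p.symm.trans γ).trans p) e =
      τ (hF.isCoveringMap.monodromy γ (τ.symm e))
    rw [IsCoveringMap.monodromy_trans_apply, IsCoveringMap.monodromy_trans_apply, ← hτ, ← hτs]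

end BelyiPolynomial

/-! ### A polynomial that detects membership in a permutation group -/

section OrbitSum

variable {ι K : Type*} [Fintype ι] [DecidableEq ι] [Field K]

open Classical in
/-- A polynomial in `x`, invariant under the permutation group `G`, which separates the orbit of
the tuple `z` under `G` from the other reorderings of `z`. -/
def orbitSum (G : Subgroup (Equiv.Perm ι)) (z x : ι → K) : K :=
  ∑ g : Equiv.Perm ι with g ∈ G, ∏ i, ∏ j ∈ Finset.univ.erase i, (x (g i) - z j)

variable (G : Subgroup (Equiv.Perm ι))

theorem orbitSum_comp_of_mem {ρ : Equiv.Perm ι} (hρ : ρ ∈ G) (z x : ι → K) :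
    orbitSum G z (x ∘ ρ) = orbitSum G z x := by
  refine Finset.sum_equiv (Equiv.mulLeft ρ) (fun g => ?_) fun g _ => rfl
  simp [G.mul_mem_cancel_left hρ]

/-- If `ρ` moves `i`, the index `j = ρ i` survives the erasure and contributes the factor `z (ρ i) -
z (ρ i)`. -/
theorem prod_erase_sub_eq_zero {ρ : Equiv.Perm ι} (hρ : ρ ≠ 1) (z : ι → K) :
    ∏ i, ∏ j ∈ Finset.univ.erase i, (z (ρ i) - z j) = 0 := by
  obtain ⟨i, hi⟩ : ∃ i, ρ i ≠ i := by
    by_contra! h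
    exact hρ (Equiv.ext h)
  exact Finset.prod_eq_zero (Finset.mem_univ i)
    (Finset.prod_eq_zero (Finset.mem_erase.mpr ⟨hi, Finset.mem_univ _⟩) (sub_self _))

theorem orbitSum_comp_of_notMem {ρ : Equiv.Perm ι} (hρ : ρ ∉ G) (z : ι → K) :
    orbitSum G z (z ∘ ρ) = 0 := by
  refine Finset.sum_eq_zero fun g hg => prod_erase_sub_eq_zero (ρ := ρ * g) ?_ z
  intro h
  rw [mul_eq_one_iff_eq_inv] at h
  exact hρ (h ▸ G.inv_mem (by simpa using hg))

/-- Only the summand of the identity survives, and it is a product of differences of distinct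
entries. -/
theorem orbitSum_self_ne_zero {z : ι → K} (hz : Function.Injective z) : orbitSum G z z ≠ 0 := by
  classical
  rw [orbitSum, Finset.sum_eq_single_of_mem 1 (by simp [G.one_mem])
    fun g _ hg => prod_erase_sub_eq_zero hg z]
  refine Finset.prod_ne_zero_iff.mpr fun i _ => Finset.prod_ne_zero_iff.mpr fun j hj => ?_
  exact sub_ne_zero.mpr fun h => (Finset.ne_of_mem_erase hj) (hz h).symm

theorem map_orbitSum {L : Type*} [Field L] (φ : K →+* L) (z x : ι → K) :
    φ (orbitSum G z x) = orbitSum G (φ ∘ z) (φ ∘ x) := by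
  simp [orbitSum, map_sum, map_prod]

theorem differentiable_orbitSum (z : ι → ℂ) : Differentiable ℂ (orbitSum G z) := by
  unfold orbitSum
  fun_prop

theorem norm_orbitSum_le {z x : ι → ℂ} {R : ℝ} (hR : 0 ≤ R) (hz : ∀ i, ‖z i‖ ≤ R)
    (hx : ∀ i, ‖x i‖ ≤ R) :
    ‖orbitSum G z x‖ ≤ Fintype.card (Equiv.Perm ι) *
      (2 * R) ^ ((Fintype.card ι - 1) * Fintype.card ι) := by
  classical
  have hprod : ∀ g : Equiv.Perm ι, ‖∏ i, ∏ j ∈ Finset.univ.erase i, (x (g i) - z j)‖ ≤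
      (2 * R) ^ ((Fintype.card ι - 1) * Fintype.card ι) := by
    intro g
    rw [norm_prod, pow_mul]
    refine (Finset.prod_le_prod (fun _ _ => norm_nonneg _) (g := fun _ =>
      (2 * R) ^ (Fintype.card ι - 1)) fun i _ => ?_).trans_eq (by simp)
    rw [norm_prod]
    refine (Finset.prod_le_prod (fun _ _ => norm_nonneg _) (g := fun _ => 2 * R)
      fun j _ => ?_).trans_eq (by simp [Finset.card_erase_of_mem])
    exact (norm_sub_le _ _).trans (by linarith [hx (g i), hz j])
  refine (norm_sum_le _ _).trans ((Finset.sum_le_sum fun g _ => hprod g).trans ?_)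
  rw [Finset.sum_const, nsmul_eq_mul]
  gcongr
  exact Finset.card_filter_le _ _

end OrbitSum

/-! ### The orbit sum of the transported fiber is a polynomial -/

namespace BelyiPolynomial

theorem transport_trans {F : ℂ[X]} (hF : IsBelyi F) {b t u : puncturedPlane}
    (γ : Path.Homotopic.Quotient b t) (δ : Path.Homotopic.Quotient t u) (e : Fiber F b) :
    transport hF (γ.trans δ) e = transport hF δ (hF.isCoveringMap.monodromy γ e) := by
  rw [transport, IsCoveringMap.monodromy_trans_apply, transport]

theorem transport_refl {F : ℂ[X]} (hF : IsBelyi F) {b : puncturedPlane} (e : Fiber F b) :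
    transport hF (.refl b) e = e.1.1 := by
  rw [transport, IsCoveringMap.monodromy_refl, id]

/-- A function of the fiber which is invariant under the monodromy group does not depend on the
path of transport, and it is a polynomial in the base point. -/
theorem IsBelyi.exists_eval_eq_orbitSum {F : ℂ[X]} (hF : IsBelyi F) (b : puncturedPlane)
    [Fintype (Fiber F b)] [DecidableEq (Fiber F b)] :
    ∃ c : ℂ[X], ∀ (t : puncturedPlane) (γ : Path.Homotopic.Quotient b t),
      c.eval t.1 = orbitSum (Mon hF b) (fun e => e.1.1) (transport hF γ) := by
  set z : Fiber F b → ℂ := fun e => e.1.1 with hz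
  -- Two paths differ by the loop `γ.trans δ.symm`, whose monodromy lies in the group under which
  -- the orbit sum is invariant.
  have hindep : ∀ (t : puncturedPlane) (γ δ : Path.Homotopic.Quotient b t),
      orbitSum (Mon hF b) z (transport hF γ) = orbitSum (Mon hF b) z (transport hF δ) := by
    intro t γ δ
    rw [← orbitSum_comp_of_mem (Mon hF b) (ρ := hF.isCoveringMap.monodromyPerm b (γ.trans δ.symm))
      ⟨_, rfl⟩ z (transport hF δ)]
    congr 1
    funext e
    rw [Function.comp_apply, IsCoveringMap.coe_monodromyPerm, ← transport_trans,
      Path.Homotopic.Quotient.trans_assoc, Path.Homotopic.Quotient.symm_trans,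
      Path.Homotopic.Quotient.trans_refl]
  let p : ∀ t : puncturedPlane, Path.Homotopic.Quotient b t :=
    fun t => .mk (PathConnectedSpace.somePath b t)
  classical
  let φ : ℂ → ℂ := fun t => if ht : t ∈ puncturedPlane then
    orbitSum (Mon hF b) z (transport hF (p ⟨t, ht⟩)) else 0
  have hφ : ∀ t (γ : Path.Homotopic.Quotient b t),
      φ t.1 = orbitSum (Mon hF b) z (transport hF γ) := fun t γ => by
    simp only [φ, dif_pos t.2]
    exact hindep t _ _
  have hdiff : DifferentiableOn ℂ φ puncturedPlane := by
    intro t₀ ht₀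
    obtain ⟨r, hr, hball, s, hsd, -, -, hst⟩ := hF.exists_sections ⟨t₀, ht₀⟩
    have hnhds : ball t₀ r ∈ 𝓝 t₀ := ball_mem_nhds t₀ hr
    have hd : DifferentiableAt ℂ (fun t => orbitSum (Mon hF b) z
        (fun e => s (hF.isCoveringMap.monodromy (p ⟨t₀, ht₀⟩) e) t)) t₀ :=
      (differentiable_orbitSum _ z).differentiableAt.comp (f := fun t e =>
        s (hF.isCoveringMap.monodromy (p ⟨t₀, ht₀⟩) e) t) t₀
        (differentiableAt_pi.mpr fun e => (hsd _).differentiableAt hnhds)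
    refine (hd.congr_of_eventuallyEq ?_).differentiableWithinAt
    filter_upwards [hnhds] with t ht
    obtain ⟨γ, hγ⟩ := hst ⟨t, hball ht⟩ ht
    rw [hφ ⟨t, hball ht⟩ ((p ⟨t₀, ht₀⟩).trans γ)]
    congr 1
    funext e
    rw [transport_trans, hγ]
  obtain ⟨K, hK, hKb⟩ := exists_norm_le_of_eval_eq hF.natDegree_pos
  set n := (Fintype.card (Fiber F b) - 1) * Fintype.card (Fiber F b) with hn
  have hbound : ∀ t ∈ puncturedPlane, ‖φ t‖ ≤
      (Fintype.card (Equiv.Perm (Fiber F b)) * (2 * (K * (1 + ‖b.1‖))) ^ n) * (1 + ‖t‖) ^ n := by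
    intro t ht
    rw [hφ ⟨t, ht⟩ (p ⟨t, ht⟩)]
    refine (norm_orbitSum_le _ (R := K * (1 + ‖b.1‖) * (1 + ‖t‖)) (by positivity) (fun e => ?_)
      fun e => ?_).trans_eq ?_
    · exact (hKb _ _ e.eval_eq).trans
        (le_mul_of_one_le_right (by positivity) (by linarith [norm_nonneg t]))
    · refine (hKb _ _ (eval_transport hF _ e)).trans ?_
      have h1 := mul_nonneg hK.le (norm_nonneg b.1)
      have h2 : 0 ≤ 1 + ‖t‖ := by positivity
      change K * (1 + ‖t‖) ≤ _
      nlinarith [mul_nonneg h1 h2]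
    · rw [← hn, ← mul_assoc 2, mul_pow _ (1 + ‖t‖), ← mul_assoc]
  obtain ⟨c, hc⟩ := hdiff.exists_polynomial_of_norm_le hbound
  exact ⟨c, fun t γ => (hc t.1 t.2).trans (hφ t γ)⟩

/-! ### Continuation of holomorphic relations between points of a fiber -/

/-- The tuples of points in a common unramified fiber. -/
def fiberTuples (F : ℂ[X]) (ι : Type*) : Set (ι → ℂ) :=
  {y | ∃ t ∈ puncturedPlane, ∀ i, F.eval (y i) = t}

/-- `F` is injective near each `s i t₀`, so a nearby tuple in a common fiber is determined by its
base point, read off from the coordinate `i₀`. Thus `fiberTuples` is locally a curve parametrised by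
`t`. -/
theorem eventually_eq_sections {F : ℂ[X]} (hF : IsBelyi F) {ι : Type*} [Finite ι] (i₀ : ι)
    {t₀ : ℂ} (ht₀ : t₀ ∈ puncturedPlane) {D : Set ℂ} (hD : D ∈ 𝓝 t₀) {s : ι → ℂ → ℂ}
    (hs : ∀ i, ContinuousAt (s i) t₀) (hsF : ∀ i, ∀ t ∈ D, F.eval (s i t) = t) :
    ∀ᶠ y in 𝓝[fiberTuples F ι] (fun i => s i t₀),
      F.eval (y i₀) ∈ D ∧ ∀ i, y i = s i (F.eval (y i₀)) := by
  have ht₀D : t₀ ∈ D := mem_of_mem_nhds hD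
  have hinj : ∀ i, ∃ N ∈ 𝓝 (s i t₀), Set.InjOn (fun z => F.eval z) N := by
    intro i
    have hd := F.hasStrictDerivAt (s i t₀)
    have hne := hF.derivative_ne_zero (z := s i t₀) (by rw [hsF i t₀ ht₀D]; exact ht₀)
    let φ := (hd.hasStrictFDerivAt_equiv hne).toOpenPartialHomeomorph (fun z => F.eval z)
    exact ⟨φ.source, φ.open_source.mem_nhds
      (hd.hasStrictFDerivAt_equiv hne).mem_toOpenPartialHomeomorph_source, φ.injOn⟩
  choose N hN hNinj using hinj
  have hF0 : Tendsto (fun y : ι → ℂ => F.eval (y i₀)) (𝓝 fun i => s i t₀) (𝓝 t₀) := by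
    have h : ContinuousAt (fun y : ι → ℂ => F.eval (y i₀)) (fun i => s i t₀) :=
      (F.continuous.comp (continuous_apply i₀)).continuousAt
    have h2 := h.tendsto
    simp only [hsF i₀ t₀ ht₀D] at h2
    exact h2
  have h1 : ∀ᶠ y : ι → ℂ in 𝓝 fun i => s i t₀, ∀ i, y i ∈ N i :=
    eventually_all.mpr fun i => (continuous_apply i).continuousAt.eventually (hN i)
  have h2 : ∀ᶠ y : ι → ℂ in 𝓝 fun i => s i t₀, ∀ i, s i (F.eval (y i₀)) ∈ N i :=
    eventually_all.mpr fun i => ((hs i).tendsto.comp hF0).eventually (hN i)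
  filter_upwards [nhdsWithin_le_nhds h1, nhdsWithin_le_nhds h2,
    nhdsWithin_le_nhds (hF0.eventually hD), self_mem_nhdsWithin] with y hy1 hy2 hy3 hy4
  refine ⟨hy3, fun i => hNinj i (hy1 i) (hy2 i) ?_⟩
  obtain ⟨t, -, ht⟩ := hy4
  change F.eval (y i) = F.eval (s i (F.eval (y i₀)))
  rw [hsF i _ hy3, ht, ht]

/-- The locus where a holomorphic function vanishes identically is locally constant on the space of
tuples in a common fiber. -/
theorem eventually_vanishing_iff {F : ℂ[X]} (hF : IsBelyi F) {ι : Type*} [Fintype ι] [Nonempty ι]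
    {f : (ι → ℂ) → ℂ} (hf : Differentiable ℂ f) {x : ι → ℂ} (hx : x ∈ fiberTuples F ι) :
    ∀ᶠ y in 𝓝[fiberTuples F ι] x,
      ((∀ᶠ w in 𝓝[fiberTuples F ι] x, f w = 0) ↔ ∀ᶠ w in 𝓝[fiberTuples F ι] y, f w = 0) := by
  obtain ⟨t₀, ht₀, hxt⟩ := hx
  obtain ⟨r, hr, hball, s', hsd', hs0', hsF', -⟩ := hF.exists_sections ⟨t₀, ht₀⟩
  let s : ι → ℂ → ℂ := fun i => s' (Fiber.mk (x i) (hxt i))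
  have hsd : ∀ i, DifferentiableOn ℂ (s i) (ball t₀ r) := fun i => hsd' _
  have hsF : ∀ i, ∀ t ∈ ball t₀ r, F.eval (s i t) = t := fun i => hsF' _
  have hs0 : (fun i => s i t₀) = x := funext fun i => hs0' _
  have hscont : ∀ i, ∀ t ∈ ball t₀ r, ContinuousAt (s i) t := fun i t ht =>
    ((hsd i).differentiableAt (isOpen_ball.mem_nhds ht)).continuousAt
  have i₀ : ι := Classical.arbitrary ι
  have hloc : ∀ᶠ y in 𝓝[fiberTuples F ι] x,
      F.eval (y i₀) ∈ ball t₀ r ∧ ∀ i, y i = s i (F.eval (y i₀)) := by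
    rw [← hs0]
    exact eventually_eq_sections hF i₀ ht₀ (ball_mem_nhds t₀ hr)
      (fun i => hscont i t₀ (mem_ball_self hr)) hsF
  have hg : AnalyticOnNhd ℂ (fun t => f fun i => s i t) (ball t₀ r) := by
    refine DifferentiableOn.analyticOnNhd (fun t ht => ?_) isOpen_ball
    exact (hf.differentiableAt.comp (f := fun t i => s i t) t (differentiableAt_pi.mpr fun i =>
      (hsd i).differentiableAt (isOpen_ball.mem_nhds ht))).differentiableWithinAt
  -- vanishing near a tuple is vanishing of the pulled back function near its base point
  have hiff : ∀ t ∈ ball t₀ r, (∀ᶠ w in 𝓝[fiberTuples F ι] (fun i => s i t), f w = 0) ↔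
      ∀ᶠ u in 𝓝 t, f (fun i => s i u) = 0 := by
    intro t ht
    constructor
    · intro h
      have htend : Tendsto (fun u i => s i u) (𝓝 t) (𝓝[fiberTuples F ι] fun i => s i t) := by
        refine tendsto_nhdsWithin_iff.mpr ⟨tendsto_pi_nhds.mpr fun i => hscont i t ht, ?_⟩
        filter_upwards [isOpen_ball.mem_nhds ht] with u hu
        exact ⟨u, hball hu, fun i => hsF i u hu⟩
      exact htend.eventually h
    · intro h
      have htend : Tendsto (fun y : ι → ℂ => F.eval (y i₀))
          (𝓝[fiberTuples F ι] fun i => s i t) (𝓝 t) := by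
        have h2 : ContinuousAt (fun y : ι → ℂ => F.eval (y i₀)) (fun i => s i t) :=
          (F.continuous.comp (continuous_apply i₀)).continuousAt
        have h3 := h2.tendsto
        simp only [hsF i₀ t ht] at h3
        exact h3.mono_left nhdsWithin_le_nhds
      filter_upwards [htend.eventually h, eventually_eq_sections hF i₀ (hball ht)
        (isOpen_ball.mem_nhds ht) (fun i => hscont i t ht) hsF] with y hy1 hy2
      rwa [← funext hy2.2] at hy1
  filter_upwards [hloc] with y hy
  set t := F.eval (y i₀) with ht
  have hyt : y = fun i => s i t := funext hy.2
  rw [hyt, ← hs0, hiff t hy.1, hiff t₀ (mem_ball_self hr)]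
  have hpre : IsPreconnected (ball t₀ r) := (convex_ball t₀ r).isPreconnected
  constructor
  · intro h
    have := hg.eqOn_zero_of_preconnected_of_eventuallyEq_zero hpre (mem_ball_self hr) h
    filter_upwards [isOpen_ball.mem_nhds hy.1] with u hu using this hu
  · intro h
    have := hg.eqOn_zero_of_preconnected_of_eventuallyEq_zero hpre hy.1 h
    filter_upwards [ball_mem_nhds t₀ hr] with u hu using this hu

/-- The identity theorem along paths: a holomorphic relation between points of a fiber persists
under transport. -/
theorem eq_zero_of_transport {F : ℂ[X]} (hF : IsBelyi F) {ι : Type*} [Fintype ι] [Nonempty ι]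
    {f : (ι → ℂ) → ℂ} (hf : Differentiable ℂ f) {b t : puncturedPlane} (e : ι → Fiber F b)
    (h : ∀ᶠ y in 𝓝[fiberTuples F ι] (fun i => (e i).1.1), f y = 0)
    (γ : Path.Homotopic.Quotient b t) : f (fun i => transport hF γ (e i)) = 0 := by
  obtain ⟨γ⟩ := γ
  let cov := hF.isCoveringMap
  have hsrc : ∀ i, γ 0 = restrictedMap F (e i).1 := fun i => γ.source.trans (e i).2.symm
  let w : unitInterval → ι → ℂ := fun u i => (cov.liftPath γ (e i).1 (hsrc i) u).1
  have hwc : Continuous w := continuous_pi fun i =>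
    continuous_subtype_val.comp (cov.liftPath γ (e i).1 (hsrc i)).continuous
  have hwF : ∀ u i, F.eval (w u i) = (γ u).1 := fun u i =>
    congr_arg Subtype.val (congr_fun (cov.liftPath_lifts γ (e i).1 (hsrc i)) u)
  have hwmem : ∀ u, w u ∈ fiberTuples F ι := fun u => ⟨γ u, (γ u).2, hwF u⟩
  have hw0 : w 0 = fun i => (e i).1.1 := funext fun i =>
    congr_arg Subtype.val (cov.liftPath_zero γ (e i).1 (hsrc i))
  let Good : unitInterval → Prop := fun u => ∀ᶠ y in 𝓝[fiberTuples F ι] (w u), f y = 0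
  -- `Good` is locally constant along the lifted path `w`, and the unit interval is connected.
  have hstep : ∀ u v, Good u → Good v := by
    intro u v
    refine PreconnectedSpace.induction₂' (fun u v => Good u → Good v) (fun u => ?_)
      ⟨fun _ _ _ h h' => h' ∘ h⟩ u v
    have htend : Tendsto w (𝓝 u) (𝓝[fiberTuples F ι] (w u)) :=
      tendsto_nhdsWithin_iff.mpr ⟨hwc.continuousAt, Eventually.of_forall hwmem⟩
    filter_upwards [htend.eventually (eventually_vanishing_iff hF hf (hwmem u))] with v hv
    exact ⟨hv.1, hv.2⟩
  have h1 : Good 1 := hstep 0 1 (by simpa only [Good, hw0] using h)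
  exact h1.self_of_nhdsWithin (hwmem 1)

/-! ### Galois conjugation and comparison of the monodromy groups -/

theorem eval_toComplex (f : QBar[X]) (ζ : QBar) :
    (toComplex f).eval (algebraMap QBar ℂ ζ) = algebraMap QBar ℂ (f.eval ζ) := by
  rw [toComplex, eval_map_algebraMap, aeval_algebraMap_apply, coe_aeval_eq_eval]

theorem eval_twist (σ : Gal(QBar/ℚ)) (f : QBar[X]) (ζ : QBar) :
    (twist σ f).eval (σ ζ) = σ (f.eval ζ) :=
  eval_map_apply (f := (σ : QBar →+* QBar)) (p := f) ζ

theorem twist_iter (σ : Gal(QBar/ℚ)) (f : QBar[X]) (n : ℕ) :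
    twist σ (iter f n) = iter (twist σ f) n := by
  induction n with
  | zero => simp [iter, twist]
  | succ n ih =>
    simp only [iter, Function.iterate_succ_apply'] at ih ⊢
    rw [← ih]
    simp [twist, Polynomial.map_comp]

theorem twist_inv_twist (σ : Gal(QBar/ℚ)) (f : QBar[X]) : twist σ⁻¹ (twist σ f) = f := by
  ext i
  simp only [twist, coeff_map]
  congr 1
  exact σ.symm_apply_apply (f.coeff i)

theorem exists_algebraMap_eq_of_eval_eq {f : QBar[X]} (hf : 0 < (toComplex f).natDegree) {q : QBar}
    {z : ℂ} (hz : (toComplex f).eval z = algebraMap QBar ℂ q) : ∃ ζ, algebraMap QBar ℂ ζ = z := by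
  have hne : f - C q ≠ 0 := by
    intro h
    rw [sub_eq_zero.mp h] at hf
    simp [toComplex] at hf
  have h1 : IsAlgebraic QBar z := by
    refine ⟨f - C q, hne, ?_⟩
    rw [map_sub, aeval_C, ← hz, toComplex, eval_map_algebraMap, sub_self]
  have : Algebra.IsAlgebraic ℚ QBar := by
    convert algebraicClosure.isAlgebraic ℚ ℂ
    · rfl
    · exact Subsingleton.elim _ _
  have h2 : IsAlgebraic ℚ z := h1.restrictScalars ℚ
  exact ⟨⟨z, mem_algebraicClosure_iff.mpr h2⟩, rfl⟩

/-- The monodromy group of a Galois conjugate, at a rational base point, is contained in a conjugate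
of the monodromy group. -/
theorem exists_mon_twist_le (f : QBar[X]) (σ : Gal(QBar/ℚ)) (hF : IsBelyi (toComplex f))
    (hF' : IsBelyi (toComplex (twist σ f))) (b : puncturedPlane) (hb : b.1 = 2) :
    ∃ τ : Fiber (toComplex f) b ≃ Fiber (toComplex (twist σ f)) b,
      Mon hF' b ≤ (Mon hF b).map (τ.permCongrHom : _ →* _) := by
  classical
  set F := toComplex f with hFdef
  set F' := toComplex (twist σ f) with hFdef'
  have := hF.finite_fiber b
  have := hF.nonempty_fiber b
  have : Fintype (Fiber F b) := Fintype.ofFinite _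
  let K : QBar →+* ℂ := algebraMap QBar ℂ
  have hK : Function.Injective K := K.injective
  have hbK : b.1 = K 2 := by rw [hb, map_ofNat]
  have hσ2 : σ 2 = 2 := map_ofNat σ 2
  -- the Galois action identifies the fibers over a rational point
  have hζ : ∀ e : Fiber F b, ∃ ζ, K ζ = e.1.1 := fun e =>
    exists_algebraMap_eq_of_eval_eq hF.natDegree_pos (e.eval_eq.trans hbK)
  choose ζ hζ using hζ
  have hconj : ∀ q ξ : QBar, F.eval (K ξ) = K q → F'.eval (K (σ ξ)) = K (σ q) := by
    intro q ξ h
    rw [eval_toComplex] at h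
    rw [hFdef', eval_toComplex, eval_twist, hK h]
  have hx'F : ∀ e, F'.eval (K (σ (ζ e))) = b.1 := fun e => by
    rw [hconj 2 (ζ e) (by rw [hζ, e.eval_eq, hbK]), hσ2, hbK]
  have hinj : Function.Injective fun e => K (σ (ζ e)) := by
    intro e e' h
    have h1 : ζ e = ζ e' := σ.injective (hK h)
    exact Fiber.coe_injective (by change e.1.1 = e'.1.1; rw [← hζ, ← hζ, h1])
  let τ : Fiber F b ≃ Fiber F' b := Equiv.ofBijective (fun e => Fiber.mk _ (hx'F e)) <| by
    refine ⟨fun e e' h => hinj (congr_arg (fun e : Fiber F' b => e.1.1) h), fun y => ?_⟩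
    obtain ⟨η, hη⟩ := exists_algebraMap_eq_of_eval_eq hF'.natDegree_pos (y.eval_eq.trans hbK)
    have hη2 : (twist σ f).eval η = 2 := hK (by
      rw [← hbK, ← y.eval_eq, ← hη, eval_toComplex])
    have hpre : F.eval (K (σ.symm η)) = b.1 := by
      rw [hFdef, eval_toComplex, hbK]
      congr 1
      refine σ.injective ?_
      rw [← eval_twist, AlgEquiv.apply_symm_apply, hη2, hσ2]
    refine ⟨Fiber.mk _ hpre, Fiber.coe_injective ?_⟩
    change K (σ (ζ (Fiber.mk _ hpre))) = y.1.1
    have h1 : ζ (Fiber.mk _ hpre) = σ.symm η := hK (hζ _)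
    rw [h1, AlgEquiv.apply_symm_apply]
    exact hη
  refine ⟨τ, ?_⟩
  set x' : Fiber F b → ℂ := fun e => K (σ (ζ e)) with hx'
  have hτ : ∀ e, (τ e).1.1 = x' e := fun _ => rfl
  set G := Mon hF b with hG
  -- the invariant polynomial has algebraic coefficients
  obtain ⟨c, hc⟩ := hF.exists_eval_eq_orbitSum b
  have halg : ∀ (q : QBar) (t : puncturedPlane) (_ : t.1 = K q)
      (γ : Path.Homotopic.Quotient b t), ∃ ξ : Fiber F b → QBar,
      (∀ e, K (ξ e) = transport hF γ e) ∧ c.eval (K q) = K (orbitSum G ζ ξ) := by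
    intro q t ht γ
    have : ∀ e, ∃ ξ, K ξ = transport hF γ e := fun e =>
      exists_algebraMap_eq_of_eval_eq hF.natDegree_pos ((eval_transport hF γ e).trans ht)
    choose ξ hξ using this
    refine ⟨ξ, hξ, ?_⟩
    rw [map_orbitSum, ← ht, hc t γ]
    congr 1
    · exact funext fun e => (hζ e).symm
    · exact funext fun e => (hξ e).symm
  obtain ⟨c₀, hc₀⟩ := c.exists_map_eq_of_infinite_eval_mem (K := QBar)
    -- The integers from 2 on are infinitely many algebraic points avoiding 0 and 1.
    (S := Set.range fun n : ℕ => (n : QBar) + 2)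
    (Set.infinite_range_of_injective fun m n h => by simpa using h) (by
      rintro _ ⟨n, rfl⟩
      have hmem : K ((n : QBar) + 2) ∈ puncturedPlane := by
        rw [map_add, map_natCast, map_ofNat]
        have h0 : ((n + 2 : ℕ) : ℂ) ≠ 0 := Nat.cast_ne_zero.mpr (by omega)
        have h1 : ((n + 2 : ℕ) : ℂ) ≠ 1 := fun h => by
          have : n + 2 = 1 := by exact_mod_cast h
          omega
        push_cast at h0 h1
        simp [h0, h1]
      obtain ⟨ξ, -, h⟩ := halg _ ⟨_, hmem⟩ rfl (.mk (PathConnectedSpace.somePath _ _))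
      exact ⟨_, h⟩)
  set c' := toComplex (twist σ c₀) with hc'
  have hc'q : ∀ (q : QBar) (t : puncturedPlane) (_ : t.1 = K q) (_ : σ q = q)
      (γ : Path.Homotopic.Quotient b t), ∃ ξ : Fiber F b → QBar,
      (∀ e, K (ξ e) = transport hF γ e) ∧ c'.eval (K q) = orbitSum G x' fun e => K (σ (ξ e)) := by
    intro q t ht hq γ
    obtain ⟨ξ, hξ, h⟩ := halg q t ht γ
    refine ⟨ξ, hξ, ?_⟩
    have h1 : c₀.eval q = orbitSum G ζ ξ := by
      refine hK ?_
      rw [← h, ← hc₀]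
      exact (eval_toComplex c₀ q).symm
    have h2 : c'.eval (K q) = K (σ (c₀.eval q)) := by
      conv_lhs => rw [← hq]
      rw [hc', eval_toComplex, eval_twist]
    rw [h2, h1]
    exact map_orbitSum G (K.comp (σ : QBar →+* QBar)) ζ ξ
  have hc'b : c'.eval b.1 = orbitSum G x' x' := by
    obtain ⟨ξ, hξ, h⟩ := hc'q 2 b hbK hσ2 (.refl b)
    rw [hbK, h]
    congr 1
    funext e
    rw [hK ((hξ e).trans ((transport_refl hF e).trans (hζ e).symm))]
  have hne : c'.eval b.1 ≠ 0 := hc'b ▸ orbitSum_self_ne_zero G hinj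
  -- the conjugate polynomial agrees with the conjugate invariant near the base point
  obtain ⟨r, hr, hball, s', hsd', hs0', hsF', hst'⟩ := hF'.exists_sections b
  let s : Fiber F b → ℂ → ℂ := fun e => s' (τ e)
  have hs0 : (fun e => s e b.1) = x' := funext fun e => hs0' _
  have hbD : ball b.1 r ∈ 𝓝 b.1 := ball_mem_nhds _ hr
  have hsda : ∀ e, DifferentiableAt ℂ (s e) b.1 := fun e => (hsd' _).differentiableAt hbD
  -- At `b` the left side is nonzero and the right side vanishes for each `ρ ∉ G`. As there are
  -- finitely many `ρ`, continuity gives one neighbourhood for all.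
  have hsep : ∀ᶠ t in 𝓝 b.1, ∀ ρ : Equiv.Perm (Fiber F b), ρ ∉ G →
      c'.eval t ≠ orbitSum G x' ((fun e => s e t) ∘ ρ) := by
    refine eventually_all.mpr fun ρ => ?_
    by_cases hρ : ρ ∈ G
    · exact Eventually.of_forall fun _ h => absurd hρ h
    have hcont : ContinuousAt (fun t => orbitSum G x' ((fun e => s e t) ∘ ρ)) b.1 :=
      (differentiable_orbitSum G x').continuous.continuousAt.comp
        (f := fun t => (fun e => s e t) ∘ ρ)
        (continuousAt_pi.mpr fun e => (hsda (ρ e)).continuousAt)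
    have hval : c'.eval b.1 ≠ orbitSum G x' ((fun e => s e b.1) ∘ ρ) := by
      rw [hs0, orbitSum_comp_of_notMem G hρ]
      exact hne
    filter_upwards [(c'.continuousAt.sub hcont).eventually_ne (sub_ne_zero.mpr hval)] with t ht _
    exact sub_ne_zero.mp ht
  -- Rational points, hence fixed by `σ`, that tend to 2 without reaching it.
  let q : ℕ → QBar := fun n => ((2 + 1 / ((n : ℚ) + 1) : ℚ) : QBar)
  have hKq : ∀ n, K (q n) = 2 + 1 / ((n : ℂ) + 1) := fun n => by
    simp only [q, map_ratCast]
    push_cast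
    rfl
  have hqlim : Tendsto (fun n => K (q n)) atTop (𝓝 b.1) := by
    have h := (tendsto_one_div_add_atTop_nhds_zero_nat (𝕜 := ℂ)).const_add 2
    rw [add_zero] at h
    rw [hb]
    exact h.congr fun n => (hKq n).symm
  have hqne : ∀ n, K (q n) ≠ b.1 := fun n h => by
    rw [hKq, hb, add_eq_left, one_div, inv_eq_zero] at h
    exact Nat.cast_add_one_ne_zero n h
  let f' : (Fiber F b → ℂ) → ℂ → ℂ := fun y t => c'.eval t - orbitSum G x' y
  have hzero : ∀ᶠ n in atTop, f' (fun e => s e (K (q n))) (K (q n)) = 0 := by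
    filter_upwards [hqlim.eventually hsep, hqlim.eventually hbD] with n hn hnD
    have hσq : σ (q n) = q n := map_ratCast σ _
    let t : puncturedPlane := ⟨K (q n), hball hnD⟩
    obtain ⟨ξ, hξ, h⟩ := hc'q (q n) t rfl hσq (.mk (PathConnectedSpace.somePath b t))
    obtain ⟨δ, hδ⟩ := hst' t hnD
    -- Since `σ` fixes `q n`, it carries the fiber of `F` over it to the fiber of `F'` over it,
    -- which the sections exhaust. The relabelling `ρ` may vary erratically with `n`; `hsep` still
    -- places it in `G`.
    have hρ : ∀ e, ∃ e', s e' (K (q n)) = K (σ (ξ e)) := fun e => by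
      have h1 : F'.eval (K (σ (ξ e))) = t.1 := by
        rw [hconj (q n) (ξ e) (by rw [hξ, eval_transport]), hσq]
      obtain ⟨y, hy⟩ := exists_transport_eq hF' δ h1
      refine ⟨τ.symm y, ?_⟩
      rw [← hy, hδ]
      simp [s, t]
    choose ρ hρ using hρ
    have hρinj : Function.Injective ρ := fun e e' hee => by
      have h1 : ξ e = ξ e' := σ.injective (hK (by rw [← hρ, ← hρ, hee]))
      exact transport_injective hF _ (by rw [← hξ, ← hξ, h1])
    let ρ' : Equiv.Perm (Fiber F b) := Equiv.ofBijective ρ (Finite.injective_iff_bijective.mp hρinj)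
    have h2 : c'.eval (K (q n)) = orbitSum G x' ((fun e => s e (K (q n))) ∘ ρ') := by
      rw [h]
      congr 1
      exact funext fun e => (hρ e).symm
    have hmem : ρ' ∈ G := by
      by_contra hcon
      exact hn ρ' hcon h2
    rw [orbitSum_comp_of_mem G hmem] at h2
    exact sub_eq_zero.mpr h2
  have hev : ∀ᶠ t in 𝓝 b.1, f' (fun e => s e t) t = 0 := by
    have han : AnalyticAt ℂ (fun t => f' (fun e => s e t) t) b.1 := by
      refine DifferentiableOn.analyticAt (s := ball b.1 r) (fun t ht => ?_) hbD
      refine (c'.differentiable.differentiableAt.sub ?_).differentiableWithinAt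
      exact (differentiable_orbitSum G x').differentiableAt.comp (f := fun t e => s e t) t
        (differentiableAt_pi.mpr fun e =>
          (hsd' (τ e)).differentiableAt (isOpen_ball.mem_nhds ht))
    refine han.frequently_zero_iff_eventually_zero.mp ?_
    have hlim : Tendsto (fun n => K (q n)) atTop (𝓝[≠] b.1) :=
      tendsto_nhdsWithin_iff.mpr ⟨hqlim, Eventually.of_forall hqne⟩
    exact hlim.frequently hzero.frequently
  -- continuation along loops
  have e₀ : Fiber F b := Classical.arbitrary _
  have hfd : Differentiable ℂ fun y : Fiber F b → ℂ => f' y (F'.eval (y e₀)) :=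
    (c'.differentiable.comp (F'.differentiable.comp (differentiable_apply e₀))).sub
      (differentiable_orbitSum G x')
  have hgood : ∀ᶠ y in 𝓝[fiberTuples F' (Fiber F b)] (fun e => (τ e).1.1),
      f' y (F'.eval (y e₀)) = 0 := by
    have hloc := eventually_eq_sections hF' e₀ b.2 hbD (s := s)
      (fun e => (hsda e).continuousAt) fun e => hsF' _
    rw [hs0] at hloc
    have htend : Tendsto (fun y : Fiber F b → ℂ => F'.eval (y e₀))
        (𝓝[fiberTuples F' (Fiber F b)] x') (𝓝 b.1) := by
      have h2 : ContinuousAt (fun y : Fiber F b → ℂ => F'.eval (y e₀)) x' :=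
        (F'.continuous.comp (continuous_apply e₀)).continuousAt
      have h3 := h2.tendsto
      simp only [hx', hx'F] at h3
      exact h3.mono_left nhdsWithin_le_nhds
    filter_upwards [hloc, htend.eventually hev] with y hy1 hy2
    rwa [← funext hy1.2] at hy2
  rintro h ⟨γ, rfl⟩
  let ρ : Equiv.Perm (Fiber F b) := τ.permCongr.symm (hF'.isCoveringMap.monodromyPerm b γ)
  have hρ : ∀ e, x' (ρ e) = transport hF' γ (τ e) := fun e => by
    rw [← hτ]
    simp [ρ, transport, Equiv.permCongr_def]
  refine ⟨ρ, ?_, τ.permCongr.apply_symm_apply _⟩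
  -- Continuation along `γ` returns to `b` with the fiber permuted by `ρ`. If `ρ ∉ G`, the orbit sum
  -- there is zero, while `c'` still has its nonzero value at `b`.
  by_contra hcon
  have h1 := eq_zero_of_transport hF' hfd τ hgood γ
  simp only [f', eval_transport] at h1
  rw [← funext hρ] at h1
  refine hne ?_
  rw [sub_eq_zero.mp h1]
  exact orbitSum_comp_of_notMem G hcon x'

/-- The inclusions for `σ` and `σ⁻¹` bound the order of each of these finite groups by that of the
other, so the first inclusion is an equality. -/
theorem permIsomorphic_mon_twist (f : QBar[X]) (σ : Gal(QBar/ℚ)) (hF : IsBelyi (toComplex f))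
    (hF' : IsBelyi (toComplex (twist σ f))) (b : puncturedPlane) (hb : b.1 = 2) :
    PermIsomorphic (Mon hF b) (Mon hF' b) := by
  obtain ⟨τ, hτ⟩ := exists_mon_twist_le f σ hF hF' b hb
  have hF'' : IsBelyi (toComplex (twist σ⁻¹ (twist σ f))) := by rwa [twist_inv_twist]
  obtain ⟨τ', hτ'⟩ := exists_mon_twist_le (twist σ f) σ⁻¹ hF' hF'' b hb
  have := hF.finite_fiber b
  have := hF'.finite_fiber b
  have hcongr : ∀ (g : QBar[X]) (_ : g = f) (hg : IsBelyi (toComplex g)),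
      Nat.card (Mon hg b) = Nat.card (Mon hF b) := by
    rintro g rfl _
    rfl
  have hcard : Nat.card (Mon hF'' b) = Nat.card (Mon hF b) := hcongr _ (twist_inv_twist σ f) hF''
  have := hF''.finite_fiber b
  refine ⟨τ, Subgroup.eq_of_le_of_card_ge hτ ?_⟩
  rw [Subgroup.card_map_of_injective (MulEquiv.injective _), ← hcard]
  exact (Subgroup.card_le_of_le hτ').trans_eq
    (Subgroup.card_map_of_injective (MulEquiv.injective _))

theorem PermIsomorphic.trans {α β δ : Type*} {G : Subgroup (Equiv.Perm α)}
    {H : Subgroup (Equiv.Perm β)} {J : Subgroup (Equiv.Perm δ)} :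
    PermIsomorphic G H → PermIsomorphic H J → PermIsomorphic G J := by
  rintro ⟨τ, rfl⟩ ⟨τ', rfl⟩
  refine ⟨τ.trans τ', ?_⟩
  rw [Subgroup.map_map]
  congr 1

end BelyiPolynomial

end

open BelyiPolynomial in
theorem theorem4p1 (f g : Polynomial QBar) (hf : f ∈ XDBP) (hg : g ∈ XDBP)
    (σ : Gal(QBar/ℚ)) (hσ : g = twist σ f) (n : ℕ) (hn : 0 < n) (b b' : puncturedPlane) :
    PermIsomorphic (Mon (isBelyi_toComplex_iter hf n) b)
      (Mon (isBelyi_toComplex_iter hg n) b') := by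
  subst hσ
  -- The comparison needs a rational base point, so that `σ` fixes it.
  let b₀ : puncturedPlane := ⟨2, by simp⟩
  refine (permIsomorphic_mon_of_basePoint _ b b₀).trans
    (PermIsomorphic.trans ?_ (permIsomorphic_mon_of_basePoint _ b₀ b'))
  have hF' : IsBelyi (toComplex (twist σ (iter f n))) := by
    rw [twist_iter]
    exact isBelyi_toComplex_iter hg n
  have h := permIsomorphic_mon_twist (iter f n) σ (isBelyi_toComplex_iter hf n) hF' b₀ rfl
  convert h using 3 <;> rw [twist_iter]
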